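/- Let $N\ge 1$, let $m\ge 2$ be an integer, let $n>0$ be real, and let $\Omega\subset\mathbb R^N$ be a bounded open set (for instance a bounded domain with smooth boundary). Let $H^m_0(\Omega)$ be the closure of $C_c^\infty(\Omega)$ in the $H^m$ norm. Put $\tilde D^m=\Delta^{m/2}$ for even $m$, $\tilde D^m=\nabla\Delta^{(m-1)/2}$ for odd $m$, and $$E(v)=-\int_\Omega|\tilde D^m v|^2\,dx+\int_\Omega v^2\,dx\qquad (v\in H^m_0(\Omega)).$$ Let $\lambda_1(\Omega)$ be the smallest eigenvalue of $(-\Delta)^m$ in $\Omega$ with Dirichlet boundary conditions, that is, the smallest $\mu$ for which some $e\in H^m_0(\Omega)\setminus\{0\}$ satisfies $\int_\Omega \tilde D^m e\cdot\tilde D^m w\,dx=\mu\int_\Omega e\,w\,dx$ for all $w\in H^m_0(\Omega)$. Consider the initial-boundary value problem $$(\psi(v))_t=(-1)^{m+1}\Delta^m v+v,\qquad \psi(v)=|v|^{-\frac n{n+1}}v\ \ (\psi(0)=0),$$ in $\Omega$ for $t>0$, with $v=Dv=\dots=D^{m-1}v=0$ on $\partial\Omega$ and $v(\cdot,0)=v_0\in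 H^m_0(\Omega)$. A solution on $[0,T)$, $0<T\le\infty$, means a function $v\in C([0,T);H^m_0(\Omega))$ with $v(0)=v_0$ such that for every $w\in H^m_0(\Omega)$ and every $t\in(0,T)$ $$\frac{d}{dt}\int_\Omega\psi(v(t))\,w\,dx=-\int_\Omega\tilde D^m v(t)\cdot\tilde D^m w\,dx+\int_\Omega v(t)\,w\,dx .$$ **Proposition.** Suppose that $\lambda_1(\Omega)<1$ and $E(v_0)>0$. 1. If $v$ is a solution on $[0,T)$, $0<T\le\infty$, then for all $t\in[0,T)$ $$\int_\Omega|v(t)|^{\frac{n+2}{n+1}}\,dx\ \ge\ \frac{n+2}{n+1}\,E(v_0)\,t .$$ 2. If $v$ is a solution on $[0,\infty)$, then $\int_\Omega|v(t)|^{\frac{n+2}{n+1}}\,dx\to+\infty$ as $t\to+\infty$, and $v$ is not uniformly bounded for $t>0$: there is no $M$ such that for every $t>0$ one has $|v(x,t)|\le M$ for almost every $x\in\Omega$. -/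

import Mathlib

open MeasureTheory Filter Topology TopologicalSpace
open scoped ENNReal ContDiff Distributions

namespace PolyParabolic

noncomputable section

/-! ### The Sobolev space `H^m_0(Ω)` -/

/-- A derivative of order at most `m`: its order `j ≤ m`, and the sequence of the `j` coordinate
directions in which one differentiates. -/
abbrev Idx (N m : ℕ) : Type := Σ j : Fin (m + 1), (Fin (j : ℕ) → Fin N)

/-- The `L²` inner product space of families of functions on `Ω` indexed by the derivatives of
order at most `m`. -/
abbrev JetSpace (N m : ℕ) (Ω : Opens (EuclideanSpace ℝ (Fin N))) : Type :=
  PiLp 2 (fun _ : Idx N m => Lp ℝ 2 (volume.restrict (Ω : Set (EuclideanSpace ℝ (Fin N)))))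

/-- The classical partial derivative `∂_{s 0} ∂_{s 1} ⋯ ∂_{s (j-1)} φ`. -/
def partialDeriv {N j : ℕ} (s : Fin j → Fin N) (φ : EuclideanSpace ℝ (Fin N) → ℝ) :
    EuclideanSpace ℝ (Fin N) → ℝ :=
  fun x => iteratedFDeriv ℝ j φ x (fun i => EuclideanSpace.single (s i) (1 : ℝ))

lemma memLp_partialDeriv {N j : ℕ} {Ω : Opens (EuclideanSpace ℝ (Fin N))}
    (s : Fin j → Fin N) (φ : 𝓓(Ω, ℝ)) :
    MemLp (partialDeriv s φ) 2
      (volume.restrict (Ω : Set (EuclideanSpace ℝ (Fin N)))) := by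
  have hc : Continuous (iteratedFDeriv ℝ j (φ : EuclideanSpace ℝ (Fin N) → ℝ)) :=
    φ.contDiff.continuous_iteratedFDeriv (by exact_mod_cast le_top)
  have hs : HasCompactSupport (iteratedFDeriv ℝ j (φ : EuclideanSpace ℝ (Fin N) → ℝ)) :=
    φ.hasCompactSupport.iteratedFDeriv j
  refine Continuous.memLp_of_hasCompactSupport ?_ ?_
  · exact (ContinuousMultilinearMap.apply ℝ (fun _ : Fin j => EuclideanSpace ℝ (Fin N)) ℝ
      (fun i => EuclideanSpace.single (s i) (1 : ℝ))).continuous.comp hc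
  · exact hs.comp_left (g := fun A : ContinuousMultilinearMap ℝ
      (fun _ : Fin j => EuclideanSpace ℝ (Fin N)) ℝ =>
        A (fun i => EuclideanSpace.single (s i) (1 : ℝ))) rfl

lemma partialDeriv_add {N j : ℕ} {Ω : Opens (EuclideanSpace ℝ (Fin N))}
    (s : Fin j → Fin N) (φ χ : 𝓓(Ω, ℝ)) :
    partialDeriv s (φ + χ : 𝓓(Ω, ℝ)) = partialDeriv s φ + partialDeriv s χ := by
  have hj : ((j : ℕ) : WithTop ℕ∞) ≤ ((⊤ : ℕ∞) : WithTop ℕ∞) := by exact_mod_cast le_top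
  funext x
  have h := iteratedFDeriv_add_apply (𝕜 := ℝ) (i := j) (x := x)
    (φ.contDiff.of_le hj).contDiffAt (χ.contDiff.of_le hj).contDiffAt
  simp only [partialDeriv, Pi.add_apply, FunLike.coe_add]
  rw [h]
  rfl

lemma partialDeriv_smul {N j : ℕ} {Ω : Opens (EuclideanSpace ℝ (Fin N))}
    (s : Fin j → Fin N) (c : ℝ) (φ : 𝓓(Ω, ℝ)) :
    partialDeriv s (c • φ : 𝓓(Ω, ℝ)) = c • partialDeriv s φ := by
  have hj : ((j : ℕ) : WithTop ℕ∞) ≤ ((⊤ : ℕ∞) : WithTop ℕ∞) := by exact_mod_cast le_top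
  funext x
  have h := iteratedFDeriv_const_smul_apply (𝕜 := ℝ) (i := j) (x := x) (a := c)
    (φ.contDiff.of_le hj).contDiffAt
  simp only [partialDeriv, Pi.smul_apply, FunLike.coe_smul]
  rw [h]
  rfl

/-- A test function on `Ω` together with all its partial derivatives of order at most `m`, as a
family of elements of `L²(Ω)`. The norm of this family is the `H^m` norm of the function. -/
def jet (N m : ℕ) (Ω : Opens (EuclideanSpace ℝ (Fin N))) :
    𝓓(Ω, ℝ) →ₗ[ℝ] JetSpace N m Ω where
  toFun φ := WithLp.toLp 2 fun I => (memLp_partialDeriv I.2 φ).toLp _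
  map_add' φ χ := by
    ext1 I
    simp only [PiLp.add_apply, ← MemLp.toLp_add, partialDeriv_add]
  map_smul' c φ := by
    ext1 I
    simp only [PiLp.smul_apply, ← MemLp.toLp_const_smul, partialDeriv_smul, RingHom.id_apply]

/-- The Sobolev space `H^m_0(Ω)`: the closure of the test functions on `Ω` in the `H^m` norm. Each
element is recorded as the family of its weak derivatives of order at most `m` in `L²(Ω)`. -/
abbrev H0 (N m : ℕ) (Ω : Opens (EuclideanSpace ℝ (Fin N))) : Type :=
  ↥(LinearMap.range (jet N m Ω)).topologicalClosure

namespace H0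

variable {N m : ℕ} {Ω : Opens (EuclideanSpace ℝ (Fin N))}

/-- The weak derivative `∂_{s 0} ⋯ ∂_{s (j-1)} v ∈ L²(Ω)` of `v ∈ H^m_0(Ω)`, for `j ≤ m`. -/
def weakDeriv (v : H0 N m Ω) {j : ℕ} (hj : j ≤ m) (s : Fin j → Fin N) :
    Lp ℝ 2 (volume.restrict (Ω : Set (EuclideanSpace ℝ (Fin N)))) :=
  (v : JetSpace N m Ω) ⟨⟨j, Nat.lt_succ_of_le hj⟩, s⟩

/-- The function `v ∈ L²(Ω)` itself. -/
def fn (v : H0 N m Ω) : Lp ℝ 2 (volume.restrict (Ω : Set (EuclideanSpace ℝ (Fin N)))) :=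
  v.weakDeriv (Nat.zero_le m) Fin.elim0

/-- The directions `(J 0, J 0, J 1, J 1, …, J (k-1), J (k-1))`. -/
def doubled {k : ℕ} (J : Fin k → Fin N) : Fin (2 * k) → Fin N :=
  fun i => J ⟨(i : ℕ) / 2, by have := i.2; omega⟩

/-- `Δ^k v = ∑ ∂_{J 0}² ⋯ ∂_{J (k-1)}² v`, for `2 k ≤ m`. -/
def laplacianPow (v : H0 N m Ω) (k : ℕ) (hk : 2 * k ≤ m) :
    Lp ℝ 2 (volume.restrict (Ω : Set (EuclideanSpace ℝ (Fin N)))) :=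
  ∑ J : Fin k → Fin N, v.weakDeriv hk (doubled J)

/-- The `i`-th component of `∇ Δ^k v`, for `2 k + 1 ≤ m`. -/
def gradLaplacianPow (v : H0 N m Ω) (k : ℕ) (hk : 2 * k + 1 ≤ m) (i : Fin N) :
    Lp ℝ 2 (volume.restrict (Ω : Set (EuclideanSpace ℝ (Fin N)))) :=
  ∑ J : Fin k → Fin N, v.weakDeriv hk (Fin.cons i (doubled J) : Fin (2 * k + 1) → Fin N)

/-- The bilinear form `∫_Ω D̃^m v · D̃^m w` of `(-Δ)^m`, where `D̃^m = Δ^{m/2}` for even `m` and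
`D̃^m = ∇ Δ^{(m-1)/2}` for odd `m`. -/
def dirichletForm (v w : H0 N m Ω) : ℝ :=
  if h : Even m then
    inner ℝ (v.laplacianPow (m / 2) (Nat.mul_div_le m 2))
      (w.laplacianPow (m / 2) (Nat.mul_div_le m 2))
  else
    ∑ i : Fin N,
      inner ℝ
        (v.gradLaplacianPow ((m - 1) / 2) (by rw [Nat.not_even_iff] at h; omega) i)
        (w.gradLaplacianPow ((m - 1) / 2) (by rw [Nat.not_even_iff] at h; omega) i)

/-- The energy `E(v) = -∫_Ω |D̃^m v|² + ∫_Ω v²`. -/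
def energy (v : H0 N m Ω) : ℝ :=
  -dirichletForm v v + ∫ x in (Ω : Set (EuclideanSpace ℝ (Fin N))), (v.fn x) ^ 2

end H0

/-! ### Dirichlet eigenvalues of `(-Δ)^m` -/

/-- The eigenvalues of `(-Δ)^m` in `Ω` with Dirichlet boundary conditions: the `μ` for which
`(-Δ)^m e = μ e` has a nonzero weak solution `e ∈ H^m_0(Ω)`. -/
def dirichletEigenvalues (N m : ℕ) (Ω : Opens (EuclideanSpace ℝ (Fin N))) : Set ℝ :=
  {μ | ∃ e : H0 N m Ω, e ≠ 0 ∧ ∀ w : H0 N m Ω,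
    e.dirichletForm w = μ * ∫ x in (Ω : Set (EuclideanSpace ℝ (Fin N))), e.fn x * w.fn x}

/-! ### The parabolic problem -/

/-- The nonlinearity `ψ(y) = |y|^{-n/(n+1)} y`, with `ψ(0) = 0`. -/
def psi (n : ℝ) (y : ℝ) : ℝ := |y| ^ (-(n / (n + 1))) * y

/-- `v` is a weak (energy) solution on `Ω × [0, T)`, `0 < T ≤ ∞`, of
`(ψ(v))_t = (-1)^{m+1} Δ^m v + v` with zero Dirichlet data `v = Dv = ⋯ = D^{m-1}v = 0` on `∂Ω` and
initial data `v₀`: it is a continuous curve in `H^m_0(Ω)` that starts at `v₀` and satisfies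
`d/dt ∫_Ω ψ(v) w = -∫_Ω D̃^m v · D̃^m w + ∫_Ω v w` on `(0, T)` for every `w ∈ H^m_0(Ω)`. -/
structure IsSolution {N m : ℕ} {Ω : Opens (EuclideanSpace ℝ (Fin N))} (n : ℝ)
    (v₀ : H0 N m Ω) (T : EReal) (v : ℝ → H0 N m Ω) : Prop where
  initial : v 0 = v₀
  continuousOn : ContinuousOn v {t : ℝ | 0 ≤ t ∧ (t : EReal) < T}
  weak_form : ∀ w : H0 N m Ω, ∀ t : ℝ, 0 < t → (t : EReal) < T →
    HasDerivAt
      (fun s => ∫ x in (Ω : Set (EuclideanSpace ℝ (Fin N))), psi n ((v s).fn x) * w.fn x)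
      (-(v t).dirichletForm w +
        ∫ x in (Ω : Set (EuclideanSpace ℝ (Fin N))), (v t).fn x * w.fn x) t

end

end PolyParabolic

/-!
The problem is the gradient flow `(ψ(v))' = B(v, ·)` in the dual of `H = H^m_0(Ω)`, where
`B(v, w) = -∫ D̃^m v · D̃^m w + ∫ v w` is a bounded symmetric form with `B(v, v) = E(v)`, and
`(n + 2) v` is a subgradient of `G(v) = ∫ |v|^((n+2)/(n+1))`, regarded as a function of `ψ(v)`
(`mul_psi_sub_psi_mul_le`, an instance of Young's inequality). Formally,
`E(v)' = 2 ∫ ψ(v)_t v_t ≥ 0` and `G(v)' = (n + 2) ∫ ψ(v)_t v = (n + 2) E(v)`, so that `G(v)` grows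
at least with slope `(n + 2) E(v₀) ≥ (n + 2) / (n + 1) · E(v₀)`.

A weak solution has no time derivative `v_t`, so both identities are proved with increments, in an
abstract Banach space. If `V` is a primitive of `v`, then `ψ(v(t)) - ψ(v(s)) = B(V(t) - V(s), ·)`
(`apply_sub_apply_eq_of_hasDerivAt`). Monotonicity of `ψ` then shows that the energy of the averages
`(V(t + h) - V(t)) / h` does not decrease, and `h → 0` gives the same for `v`
(`energy_le_of_hasDerivAt`). The subgradient inequality squeezes the increments of `G(v)` between
`(n + 2) B(V(t) - V(s), v(s))` and `(n + 2) B(V(t) - V(s), v(t))`, which gives the derivative of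
`G(v)` (`hasDerivWithinAt_of_subgradient`). The equation is only available for `t > 0`; the initial
time is reached in `linear_growth_of_subgradient_flow` from the continuity of `v` in `H` and `G ≥ 0`.

Finally, a uniform bound on `v` would bound `G(v)`, since `Ω` has finite measure.
-/

namespace PolyParabolic

/-! ### Gradient flows of indefinite quadratic energies -/

section Abstract

section Pullback

variable {E F : Type*} [NormedAddCommGroup E] [NormedSpace ℝ E] [NormedAddCommGroup F]
  [InnerProductSpace ℝ F]

lemma exists_clm_neg_sum_inner_add_inner {ι : Type*} [Fintype ι] (D : ι → E →L[ℝ] F)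
    (L : E →L[ℝ] F) : ∃ B : E →L[ℝ] E →L[ℝ] ℝ,
      (∀ x y, B x y = -∑ i, inner ℝ (D i x) (D i y) + inner ℝ (L x) (L y)) ∧
      ∀ x y, B x y = B y x := by
  let I (K : E →L[ℝ] F) : E →L[ℝ] E →L[ℝ] ℝ := (innerSL ℝ).bilinearComp K K
  have hB : ∀ x y, (-∑ i, I (D i) + I L) x y =
      -∑ i, inner ℝ (D i x) (D i y) + inner ℝ (L x) (L y) := fun x y => by
    simp [I]
  refine ⟨_, hB, fun x y => ?_⟩
  rw [hB, hB, real_inner_comm (L x)]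
  simp only [real_inner_comm]

end Pullback

variable {H : Type*} [NormedAddCommGroup H] [NormedSpace ℝ H]

lemma apply_sub_apply_eq_of_hasDerivAt {B : H →L[ℝ] H →L[ℝ] ℝ} {P : H → Module.Dual ℝ H}
    {v V : ℝ → H} {a b : ℝ} (hV : ∀ t ∈ Set.Icc a b, HasDerivAt V (v t) t)
    (hP : ∀ w, ∀ t ∈ Set.Icc a b, HasDerivAt (fun s => P (v s) w) (B (v t) w) t)
    {s t : ℝ} (hs : s ∈ Set.Icc a b) (ht : t ∈ Set.Icc a b) (w : H) :
    P (v t) w - P (v s) w = B (V t - V s) w := by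
  have hd : ∀ r ∈ Set.Icc a b, HasDerivAt (fun r => P (v r) w - B (V r) w) 0 r := by
    intro r hr
    have h1 : HasDerivAt (fun r => B.flip w (V r)) (B.flip w (v r)) r :=
      (B.flip w).hasFDerivAt.comp_hasDerivAt r (hV r hr)
    exact ((hP w r hr).sub h1).congr_deriv (by simp)
  have h := (convex_Icc a b).is_const_of_fderivWithin_eq_zero (𝕜 := ℝ)
    (f := fun r => P (v r) w - B (V r) w)
    (fun r hr => (hd r hr).differentiableAt.differentiableWithinAt)
    (fun r hr => by
      by_cases hu : UniqueDiffWithinAt ℝ (Set.Icc a b) r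
      · rw [(hd r hr).hasFDerivAt.hasFDerivWithinAt.fderivWithin hu]
        ext; simp
      · exact fderivWithin_zero_of_not_uniqueDiffWithinAt hu) hs ht
  simp only [map_sub, sub_apply] at h ⊢
  linarith

/-- The energy `B(v, v)` does not decrease along a solution of `(P(v))' = B(v, ·)` with `P`
monotone. With `V` a primitive of `v`, the derivative of `B(W, W)` along the increments
`W(t) = V(t + h) - V(t)` is `2 B(W(t), v(t + h) - v(t))`, which the equation turns into the
nonnegative number `2 (P(v(t + h)) - P(v(t))) (v(t + h) - v(t))`; then `h → 0`. -/
lemma energy_le_of_hasDerivAt {B : H →L[ℝ] H →L[ℝ] ℝ} (hB : ∀ x y, B x y = B y x)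
    {P : H → Module.Dual ℝ H} (hmono : ∀ x y, 0 ≤ P y (y - x) - P x (y - x))
    {v V : ℝ → H} {a b : ℝ} (hab : a < b) (hV : ∀ t ∈ Set.Icc a b, HasDerivAt V (v t) t)
    (hP : ∀ w, ∀ t ∈ Set.Icc a b, HasDerivAt (fun s => P (v s) w) (B (v t) w) t) :
    B (v a) (v a) ≤ B (v b) (v b) := by
  have hstep : ∀ h ∈ Set.Ioo 0 (b - a),
      B (V (a + h) - V a) (V (a + h) - V a) ≤ B (V b - V (b - h)) (V b - V (b - h)) := by
    intro h hh
    obtain ⟨h0, h1⟩ := hh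
    have hd : ∀ t ∈ Set.Icc a (b - h),
        HasDerivAt (fun t => B (V (t + h) - V t) (V (t + h) - V t))
          (2 * B (V (t + h) - V t) (v (t + h) - v t)) t := by
      intro t ht
      have hW : HasDerivAt (fun t => V (t + h) - V t) (v (t + h) - v t) t :=
        ((hV (t + h) ⟨by linarith [ht.1], by linarith [ht.2]⟩).comp_add_const t h).sub
          (hV t ⟨ht.1, by linarith [ht.2]⟩)
      have := (B.hasFDerivAt.comp_hasDerivAt t hW).clm_apply hW
      refine this.congr_deriv ?_
      rw [hB (v (t + h) - v t), Function.comp_apply]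
      ring
    have hm : MonotoneOn (fun t => B (V (t + h) - V t) (V (t + h) - V t))
        (Set.Icc a (b - h)) := by
      refine monotoneOn_of_deriv_nonneg (convex_Icc _ _)
        (fun t ht => (hd t ht).continuousAt.continuousWithinAt)
        (fun t ht => (hd t (interior_subset ht)).differentiableAt.differentiableWithinAt) ?_
      intro t ht
      have ht' := interior_subset ht
      rw [(hd t ht').deriv, ← apply_sub_apply_eq_of_hasDerivAt hV hP
        ⟨ht'.1, by linarith [ht'.2]⟩ ⟨by linarith [ht'.1], by linarith [ht'.2]⟩]
      have := hmono (v t) (v (t + h))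
      positivity
    have := hm (Set.left_mem_Icc.2 (by linarith)) (Set.right_mem_Icc.2 (by linarith))
      (by linarith : a ≤ b - h)
    simpa using this
  have hE : Continuous fun x : H => B x x := B.continuous.clm_apply continuous_id
  have hla : Tendsto (fun h : ℝ => h⁻¹ • (V (a + h) - V a)) (𝓝[>] 0) (𝓝 (v a)) :=
    (hV a ⟨le_rfl, hab.le⟩).tendsto_slope_zero_right
  have hlb : Tendsto (fun h : ℝ => h⁻¹ • (V b - V (b - h))) (𝓝[>] 0) (𝓝 (v b)) := by
    have h1 := (hV b ⟨hab.le, le_rfl⟩).tendsto_slope_zero_left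
    have h2 : Tendsto (fun h : ℝ => -h) (𝓝[>] 0) (𝓝[<] 0) := by
      simpa using tendsto_neg_nhdsGT (a := (0 : ℝ))
    refine (h1.comp h2).congr fun h => ?_
    simp only [Function.comp, inv_neg, neg_smul, ← smul_neg, neg_sub, ← sub_eq_add_neg]
  refine le_of_tendsto_of_tendsto ((hE.tendsto _).comp hla) ((hE.tendsto _).comp hlb) ?_
  filter_upwards [Ioo_mem_nhdsGT (sub_pos.2 hab)] with h hh
  have hi : 0 ≤ h⁻¹ := inv_nonneg.2 hh.1.le
  simp only [Function.comp, map_smul, smul_apply, smul_eq_mul]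
  gcongr
  exact hstep h hh

/-- If `G`, regarded as a function of `P(x)`, has the subgradient `c x` at `P(x)`, then along a solution of
`(P(v))' = B(v, ·)` the function `G(v)` has derivative `c B(v, v)`: the increment of `G(v)`
between `s` and `t` lies between `c B(V t - V s, v s)` and `c B(V t - V s, v t)`. -/
lemma hasDerivWithinAt_of_subgradient {B : H →L[ℝ] H →L[ℝ] ℝ}
    {P : H → Module.Dual ℝ H} {G : H → ℝ} {c : ℝ}
    (hG : ∀ x y, c * (P y x - P x x) ≤ G y - G x)
    {v V : ℝ → H} {a b : ℝ} (hv : ContinuousOn v (Set.Icc a b))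
    (hV : ∀ t ∈ Set.Icc a b, HasDerivAt V (v t) t)
    (hP : ∀ w, ∀ t ∈ Set.Icc a b, HasDerivAt (fun s => P (v s) w) (B (v t) w) t)
    {s : ℝ} (hs : s ∈ Set.Icc a b) :
    HasDerivWithinAt (fun t => G (v t)) (c * B (v s) (v s)) (Set.Icc a b) s := by
  have hlin : HasDerivWithinAt (fun t => c * B.flip (v s) (V t)) (c * B.flip (v s) (v s))
      (Set.Icc a b) s :=
    (((B.flip (v s)).hasFDerivAt.comp_hasDerivAt s (hV s hs)).const_mul c).hasDerivWithinAt
  have hrem : HasDerivWithinAt (fun t => G (v t) - c * B.flip (v s) (V t)) 0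
      (Set.Icc a b) s := by
    rw [hasDerivWithinAt_iff_isLittleO]
    have hO : (fun t => V t - V s) =O[𝓝[Set.Icc a b] s] fun t => t - s :=
      (hV s hs).hasDerivWithinAt.hasFDerivWithinAt.isBigO_sub
    have ho : (fun t => v t - v s) =o[𝓝[Set.Icc a b] s] fun _ => (1 : ℝ) := by
      rw [Asymptotics.isLittleO_one_iff]
      simpa using (hv s hs).sub_const (v s)
    have hprod := hO.norm_norm.mul_isLittleO ho.norm_norm
    refine Asymptotics.IsBigO.trans_isLittleO (g := fun t => ‖V t - V s‖ * ‖v t - v s‖) ?_ ?_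
    · refine Asymptotics.IsBigO.of_bound (|c| * ‖B‖) ?_
      filter_upwards [self_mem_nhdsWithin] with t ht
      have h1 := hG (v s) (v t)
      have h2 := hG (v t) (v s)
      rw [apply_sub_apply_eq_of_hasDerivAt hV hP hs ht] at h1
      rw [apply_sub_apply_eq_of_hasDerivAt hV hP ht hs] at h2
      have h3 : |c * B (V t - V s) (v t - v s)| ≤ |c| * ‖B‖ * (‖V t - V s‖ * ‖v t - v s‖) := by
        rw [abs_mul, mul_assoc, ← mul_assoc ‖B‖]
        gcongr
        exact B.le_opNorm₂ _ _
      rw [smul_zero, sub_zero, Real.norm_eq_abs, norm_mul, norm_norm, norm_norm]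
      refine le_trans ?_ h3
      refine le_trans ?_ (le_abs_self _)
      rw [abs_of_nonneg]
      · simp only [ContinuousLinearMap.flip_apply, map_sub, sub_apply] at h1 h2 ⊢
        linarith
      · simp only [ContinuousLinearMap.flip_apply, map_sub, sub_apply] at h1 h2 ⊢
        linarith
    · have := hprod.norm_right
      simp only [norm_norm, norm_one, mul_one] at this
      exact this.of_norm_right
  refine ((hrem.add hlin).congr_deriv (by simp)).congr_of_eventuallyEq
    (Eventually.of_forall fun t => ?_) ?_ <;> simp

lemma exists_hasDerivAt_of_continuousOn_Icc [CompleteSpace H] {v : ℝ → H} {a b : ℝ}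
    (hab : a ≤ b) (hv : ContinuousOn v (Set.Icc a b)) :
    ∃ V : ℝ → H, ∀ t ∈ Set.Icc a b, HasDerivAt V (v t) t := by
  have hc : Continuous (Set.IccExtend hab ((Set.Icc a b).domRestrict v)) :=
    (continuousOn_iff_continuous_domRestrict.1 hv).Icc_extend'
  refine ⟨fun t => ∫ τ in a..t, Set.IccExtend hab ((Set.Icc a b).domRestrict v) τ, fun t ht => ?_⟩
  have := hc.integral_hasStrictDerivAt a t
  rw [Set.IccExtend_of_mem hab _ ht] at this
  exact this.hasDerivAt

/-- Let `(P(v))' = B(v, ·)` on `(0, T)` with `v` continuous on `[0, T)`, where the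
nonnegative function `G` of `P(x)` has the subgradient `c x`. Then `G(v)` grows at least linearly, with slope `c`
times the initial energy. -/
theorem linear_growth_of_subgradient_flow [CompleteSpace H] {B : H →L[ℝ] H →L[ℝ] ℝ}
    (hB : ∀ x y, B x y = B y x) {P : H → Module.Dual ℝ H} {G : H → ℝ} {c : ℝ} (hc : 0 < c)
    (hG0 : ∀ x, 0 ≤ G x) (hG : ∀ x y, c * (P y x - P x x) ≤ G y - G x)
    {v : ℝ → H} {T : EReal} (hv : ContinuousOn v {t : ℝ | 0 ≤ t ∧ (t : EReal) < T})
    (hP : ∀ w, ∀ t : ℝ, 0 < t → (t : EReal) < T →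
      HasDerivAt (fun s => P (v s) w) (B (v t) w) t)
    {t : ℝ} (ht : 0 ≤ t) (htT : (t : EReal) < T) :
    c * B (v 0) (v 0) * t ≤ G (v t) := by
  have hmono : ∀ x y, 0 ≤ P y (y - x) - P x (y - x) := by
    intro x y
    have h1 := hG x y
    have h2 := hG y x
    have : 0 ≤ c * (P y (y - x) - P x (y - x)) := by
      simp only [map_sub]; linarith
    exact nonneg_of_mul_nonneg_right this hc
  rcases ht.eq_or_lt with rfl | ht
  · simpa using hG0 _
  have hsub : ∀ {a b : ℝ}, 0 ≤ a → b ≤ t →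
      Set.Icc a b ⊆ {t : ℝ | 0 ≤ t ∧ (t : EReal) < T} := fun ha hb r hr =>
    ⟨ha.trans hr.1, (EReal.coe_le_coe_iff.2 (hr.2.trans hb)).trans_lt htT⟩
  have hP' : ∀ {a b : ℝ}, 0 < a → b ≤ t → ∀ w, ∀ r ∈ Set.Icc a b,
      HasDerivAt (fun s => P (v s) w) (B (v r) w) r := fun ha hb w r hr =>
    hP w r (ha.trans_le hr.1) (hsub ha.le hb hr).2
  have hE : Continuous fun x : H => B x x := B.continuous.clm_apply continuous_id
  have hcont0 : Tendsto v (𝓝[>] 0) (𝓝 (v 0)) := by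
    have h1 := (hv.mono (hsub le_rfl le_rfl)) 0 ⟨le_rfl, ht.le⟩
    exact h1.mono_left (nhdsWithin_le_of_mem (mem_of_superset (Ioo_mem_nhdsGT ht)
      Set.Ioo_subset_Icc_self))
  have henergy : ∀ r, 0 < r → r ≤ t → B (v 0) (v 0) ≤ B (v r) (v r) := by
    intro r hr hrt
    refine le_of_tendsto ((hE.tendsto _).comp hcont0) ?_
    filter_upwards [Ioo_mem_nhdsGT hr] with s hs
    obtain ⟨V, hV⟩ := exists_hasDerivAt_of_continuousOn_Icc hs.2.le
      (hv.mono (hsub hs.1.le hrt))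
    exact energy_le_of_hasDerivAt hB hmono hs.2 hV (hP' hs.1 hrt)
  have hpos : ∀ s ∈ Set.Ioo 0 t, c * B (v 0) (v 0) * (t - s) ≤ G (v t) := by
    intro s hs
    have hvs := hv.mono (hsub hs.1.le le_rfl)
    obtain ⟨V, hV⟩ := exists_hasDerivAt_of_continuousOn_Icc hs.2.le hvs
    have hd := fun r (hr : r ∈ Set.Icc s t) =>
      hasDerivWithinAt_of_subgradient hG hvs hV (hP' hs.1 le_rfl) hr
    have hd' := fun r (hr : r ∈ interior (Set.Icc s t)) =>
      (hd r (interior_subset hr)).hasDerivAt (mem_interior_iff_mem_nhds.1 hr)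
    have := (convex_Icc s t).mul_sub_le_image_sub_of_le_deriv
      (fun r hr => (hd r hr).continuousWithinAt)
      (fun r hr => (hd' r hr).differentiableAt.differentiableWithinAt)
      (C := c * B (v 0) (v 0)) (fun r hr => by
        rw [(hd' r hr).deriv]
        have hr' := interior_subset hr
        exact mul_le_mul_of_nonneg_left (henergy r (hs.1.trans_le hr'.1) hr'.2) hc.le)
      s ⟨le_rfl, hs.2.le⟩ t ⟨hs.2.le, le_rfl⟩ hs.2.le
    linarith [hG0 (v s)]
  have hlim : Tendsto (fun s : ℝ => c * B (v 0) (v 0) * (t - s)) (𝓝[>] 0)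
      (𝓝 (c * B (v 0) (v 0) * (t - 0))) :=
    tendsto_nhdsWithin_of_tendsto_nhds (by fun_prop : Continuous fun s : ℝ =>
      c * B (v 0) (v 0) * (t - s)).continuousAt
  rw [sub_zero] at hlim
  refine le_of_tendsto hlim ?_
  filter_upwards [Ioo_mem_nhdsGT ht] with s hs using hpos s hs

end Abstract

/-! ### The nonlinearity `ψ` -/

section Nonlinearity

variable {n : ℝ}

lemma abs_psi (hn : 0 < n) (y : ℝ) : |psi n y| = |y| ^ (1 / (n + 1)) := by
  rcases eq_or_ne y 0 with rfl | hy
  · simp [psi, Real.zero_rpow (by positivity : (n + 1)⁻¹ ≠ 0)]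
  · have hy' : 0 < |y| := abs_pos.2 hy
    rw [psi, abs_mul, abs_of_nonneg (by positivity)]
    nth_rewrite 2 [← Real.rpow_one |y|]
    rw [← Real.rpow_add hy']
    congr 1
    field_simp
    ring

lemma psi_mul_self (hn : 0 < n) (y : ℝ) : psi n y * y = |y| ^ ((n + 2) / (n + 1)) := by
  have h : psi n y * y = |psi n y| * |y| := by
    rw [psi, abs_mul, abs_of_nonneg (by positivity : 0 ≤ |y| ^ (-(n / (n + 1)))), mul_assoc,
      mul_assoc, abs_mul_abs_self]
  rw [h, abs_psi hn]
  nth_rewrite 2 [← Real.rpow_one |y|]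
  rw [← Real.rpow_add_of_nonneg (abs_nonneg y) (by positivity) zero_le_one]
  congr 1
  field_simp
  ring

/-- Regarded as a function of `ψ(y)`, the power `|y|^((n+2)/(n+1))` has the subgradient `(n + 2) x`
at `ψ(x)`. This is Young's inequality for the conjugate exponents `(n + 2) / (n + 1)` and `n + 2`, applied to
`x` and `ψ(y)`. -/
lemma mul_psi_sub_psi_mul_le (hn : 0 < n) (x y : ℝ) :
    (n + 2) * (psi n y * x - psi n x * x) ≤
      |y| ^ ((n + 2) / (n + 1)) - |x| ^ ((n + 2) / (n + 1)) := by
  have hpq : ((n + 2) / (n + 1)).HolderConjugate (n + 2) := by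
    rw [Real.holderConjugate_iff]
    refine ⟨by rw [lt_div_iff₀ (by positivity)]; linarith, ?_⟩
    field_simp
    ring
  have hY := Real.young_inequality x (psi n y) hpq
  rw [abs_psi hn, ← Real.rpow_mul (abs_nonneg y), one_div_mul_eq_div, mul_comm x] at hY
  rw [psi_mul_self hn]
  have h := mul_le_mul_of_nonneg_left hY (by positivity : 0 ≤ n + 2)
  rw [mul_add] at h
  have e1 : ∀ z : ℝ, (n + 2) * (z / ((n + 2) / (n + 1))) = (n + 1) * z := by
    intro z; field_simp
  have e2 : ∀ z : ℝ, (n + 2) * (z / (n + 2)) = z := by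
    intro z; field_simp
  rw [e1, e2] at h
  linarith

lemma abs_psi_le (hn : 0 < n) (y : ℝ) : |psi n y| ≤ 1 + |y| := by
  rw [abs_psi hn]
  have h1 : (1 : ℝ) / (n + 1) ≤ 1 := by rw [div_le_one (by positivity)]; linarith
  calc |y| ^ (1 / (n + 1)) ≤ (1 + |y|) ^ (1 / (n + 1)) := by gcongr; linarith
    _ ≤ (1 + |y|) ^ (1 : ℝ) :=
      Real.rpow_le_rpow_of_exponent_le (by linarith [abs_nonneg y]) h1
    _ = 1 + |y| := Real.rpow_one _

lemma measurable_psi : Measurable (psi n) := by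
  unfold psi
  fun_prop

lemma memLp_psi_comp {α : Type*} [MeasurableSpace α] {μ : Measure α} [IsFiniteMeasure μ]
    (hn : 0 < n) {f : α → ℝ} (hf : MemLp f 2 μ) : MemLp (fun x => psi n (f x)) 2 μ := by
  refine ((memLp_const (1 : ℝ)).add hf.norm).mono
    (measurable_psi.comp_aemeasurable hf.aestronglyMeasurable.aemeasurable).aestronglyMeasurable
    (ae_of_all _ fun x => ?_)
  simp only [Pi.add_apply, Real.norm_eq_abs]
  rw [abs_of_nonneg (by positivity : 0 ≤ 1 + |f x|)]
  exact abs_psi_le hn _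

end Nonlinearity

/-! ### The energy form and the functional `ψ(v)` on `H^m_0(Ω)` -/

namespace H0

variable {N m : ℕ} {Ω : Opens (EuclideanSpace ℝ (Fin N))}

instance completeSpace : CompleteSpace (H0 N m Ω) :=
  (LinearMap.range (jet N m Ω)).isClosed_topologicalClosure.completeSpace_coe

/-- `weakDeriv` as a bounded linear map `H^m_0(Ω) → L²(Ω)`. -/
noncomputable def weakDerivL {j : ℕ} (hj : j ≤ m) (s : Fin j → Fin N) :
    H0 N m Ω →L[ℝ] Lp ℝ 2 (volume.restrict (Ω : Set (EuclideanSpace ℝ (Fin N)))) :=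
  (PiLp.proj 2 (fun _ : Idx N m =>
    Lp ℝ 2 (volume.restrict (Ω : Set (EuclideanSpace ℝ (Fin N)))))
      (⟨⟨j, Nat.lt_succ_of_le hj⟩, s⟩ : Idx N m)).comp
    (LinearMap.range (jet N m Ω)).topologicalClosure.subtypeL

lemma weakDerivL_apply {j : ℕ} (hj : j ≤ m) (s : Fin j → Fin N) (v : H0 N m Ω) :
    weakDerivL hj s v = v.weakDeriv hj s := rfl

lemma exists_dirichletForm_eq_sum_inner (N m : ℕ) (Ω : Opens (EuclideanSpace ℝ (Fin N))) :
    ∃ (k : ℕ) (D : Fin k → H0 N m Ω →L[ℝ]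
      Lp ℝ 2 (volume.restrict (Ω : Set (EuclideanSpace ℝ (Fin N))))),
      ∀ v w : H0 N m Ω, v.dirichletForm w = ∑ i, inner ℝ (D i v) (D i w) := by
  by_cases h : Even m
  · let D : H0 N m Ω →L[ℝ] Lp ℝ 2 (volume.restrict (Ω : Set (EuclideanSpace ℝ (Fin N)))) :=
      ∑ J : Fin (m / 2) → Fin N, weakDerivL (Nat.mul_div_le m 2) (doubled J)
    have hD : ∀ v, D v = v.laplacianPow (m / 2) (Nat.mul_div_le m 2) := fun v => by
      simp [D, laplacianPow, weakDerivL_apply]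
    refine ⟨1, fun _ => D, fun v w => ?_⟩
    unfold dirichletForm
    rw [dif_pos h, Fin.sum_univ_one, hD v, hD w]
  · have hm : 2 * ((m - 1) / 2) + 1 ≤ m := by rw [Nat.not_even_iff] at h; omega
    let D (i : Fin N) :
        H0 N m Ω →L[ℝ] Lp ℝ 2 (volume.restrict (Ω : Set (EuclideanSpace ℝ (Fin N)))) :=
      ∑ J : Fin ((m - 1) / 2) → Fin N,
        weakDerivL hm (Fin.cons i (doubled J) : Fin (2 * ((m - 1) / 2) + 1) → Fin N)
    have hD : ∀ i v, D i v = v.gradLaplacianPow ((m - 1) / 2) hm i := fun i v => by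
      simp [D, gradLaplacianPow, weakDerivL_apply]
    refine ⟨N, D, fun v w => ?_⟩
    unfold dirichletForm
    refine (dif_neg h).trans (Finset.sum_congr rfl fun i _ => ?_)
    rw [hD i v, hD i w]

lemma inner_fn (v w : H0 N m Ω) :
    inner ℝ v.fn w.fn = ∫ x in (Ω : Set (EuclideanSpace ℝ (Fin N))), v.fn x * w.fn x := by
  rw [L2.inner_def]
  simp [mul_comm]

set_option maxHeartbeats 1000000 in
/-- The bounded bilinear form `-∫ D̃^m v · D̃^m w + ∫ v w` polarizes the energy. -/
lemma exists_clm_energyForm :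
    ∃ B : H0 N m Ω →L[ℝ] H0 N m Ω →L[ℝ] ℝ,
      (∀ v w, B v w = -v.dirichletForm w +
        ∫ x in (Ω : Set (EuclideanSpace ℝ (Fin N))), v.fn x * w.fn x) ∧
      (∀ v w, B v w = B w v) ∧ ∀ v, B v v = v.energy := by
  obtain ⟨k, D, hD⟩ := exists_dirichletForm_eq_sum_inner N m Ω
  obtain ⟨B, hB, hsymm⟩ := exists_clm_neg_sum_inner_add_inner D
    (weakDerivL (Nat.zero_le m) Fin.elim0)
  have hB' : ∀ v w, B v w = -v.dirichletForm w +
      ∫ x in (Ω : Set (EuclideanSpace ℝ (Fin N))), v.fn x * w.fn x := fun v w => by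
    rw [hD v w, ← inner_fn v w]
    exact hB v w
  refine ⟨B, hB', hsymm, fun v => ?_⟩
  refine (hB' v v).trans ?_
  unfold energy
  simp only [pow_two]

variable [IsFiniteMeasure (volume.restrict (Ω : Set (EuclideanSpace ℝ (Fin N))))] {n : ℝ}

lemma integrable_psi_mul (hn : 0 < n) (v w : H0 N m Ω) :
    Integrable (fun x => psi n (v.fn x) * w.fn x)
      (volume.restrict (Ω : Set (EuclideanSpace ℝ (Fin N)))) :=
  (memLp_psi_comp hn (Lp.memLp v.fn)).integrable_mul (Lp.memLp w.fn)

/-- The functional `w ↦ ∫_Ω ψ(v) w` on `H^m_0(Ω)`. -/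
noncomputable def psiDual (hn : 0 < n) (v : H0 N m Ω) : Module.Dual ℝ (H0 N m Ω) where
  toFun w := ∫ x in (Ω : Set (EuclideanSpace ℝ (Fin N))), psi n (v.fn x) * w.fn x
  map_add' w z := by
    rw [← integral_add (integrable_psi_mul hn v w) (integrable_psi_mul hn v z)]
    refine integral_congr_ae ?_
    have h : (w + z).fn = w.fn + z.fn := rfl
    filter_upwards [Lp.coeFn_add w.fn z.fn] with x hx
    rw [h, hx, Pi.add_apply, mul_add]
  map_smul' c w := by
    rw [RingHom.id_apply, smul_eq_mul, ← integral_const_mul]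
    refine integral_congr_ae ?_
    have h : (c • w).fn = c • w.fn := rfl
    filter_upwards [Lp.coeFn_smul c w.fn] with x hx
    rw [h, hx, Pi.smul_apply, smul_eq_mul, mul_left_comm]

lemma psiDual_apply (hn : 0 < n) (v w : H0 N m Ω) :
    psiDual hn v w =
      ∫ x in (Ω : Set (EuclideanSpace ℝ (Fin N))), psi n (v.fn x) * w.fn x := rfl

lemma integrable_abs_rpow (hn : 0 < n) (v : H0 N m Ω) :
    Integrable (fun x => |v.fn x| ^ ((n + 2) / (n + 1)))
      (volume.restrict (Ω : Set (EuclideanSpace ℝ (Fin N)))) := by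
  simpa only [psi_mul_self hn] using integrable_psi_mul hn v v

lemma mul_psiDual_sub_le (hn : 0 < n) (v w : H0 N m Ω) :
    (n + 2) * (psiDual hn w v - psiDual hn v v) ≤
      (∫ x in (Ω : Set (EuclideanSpace ℝ (Fin N))), |w.fn x| ^ ((n + 2) / (n + 1))) -
        ∫ x in (Ω : Set (EuclideanSpace ℝ (Fin N))), |v.fn x| ^ ((n + 2) / (n + 1)) := by
  have hi := (integrable_psi_mul hn w v).sub (integrable_psi_mul hn v v)
  rw [psiDual_apply, psiDual_apply,
    ← integral_sub (integrable_psi_mul hn w v) (integrable_psi_mul hn v v),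
    ← integral_sub (integrable_abs_rpow hn w) (integrable_abs_rpow hn v), ← integral_const_mul]
  exact integral_mono (hi.const_mul _)
    ((integrable_abs_rpow hn w).sub (integrable_abs_rpow hn v))
    fun x => mul_psi_sub_psi_mul_le hn _ _

end H0

end PolyParabolic

theorem proposition2p1 (N m : ℕ) (hm : 2 ≤ m) (n : ℝ) (hn : 0 < n)
    (Ω : TopologicalSpace.Opens (EuclideanSpace ℝ (Fin N)))
    (hΩ : Bornology.IsBounded (Ω : Set (EuclideanSpace ℝ (Fin N))))
    (lam₁ : ℝ) (hlam₁ : IsLeast (PolyParabolic.dirichletEigenvalues N m Ω) lam₁)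
    (hlam₁_lt : lam₁ < 1)
    (v₀ : PolyParabolic.H0 N m Ω) (hE : 0 < v₀.energy) :
    (∀ (T : EReal) (v : ℝ → PolyParabolic.H0 N m Ω), PolyParabolic.IsSolution n v₀ T v →
      ∀ t : ℝ, 0 ≤ t → (t : EReal) < T →
        (n + 2) / (n + 1) * v₀.energy * t ≤
          ∫ x in (Ω : Set (EuclideanSpace ℝ (Fin N))),
            |(v t).fn x| ^ ((n + 2) / (n + 1))) ∧
    (∀ v : ℝ → PolyParabolic.H0 N m Ω, PolyParabolic.IsSolution n v₀ ⊤ v →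
      Tendsto (fun t : ℝ => ∫ x in (Ω : Set (EuclideanSpace ℝ (Fin N))),
        |(v t).fn x| ^ ((n + 2) / (n + 1))) atTop atTop ∧
      ¬ ∃ M : ℝ, ∀ t : ℝ, 0 < t →
        ∀ᵐ x ∂(volume.restrict (Ω : Set (EuclideanSpace ℝ (Fin N)))), |(v t).fn x| ≤ M) := by
  have hfin : IsFiniteMeasure (volume.restrict (Ω : Set (EuclideanSpace ℝ (Fin N)))) :=
    isFiniteMeasure_restrict.2 hΩ.measure_lt_top.ne
  obtain ⟨B, hB, hBsymm, hBE⟩ :=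
    PolyParabolic.H0.exists_clm_energyForm (N := N) (m := m) (Ω := Ω)
  have hgrowth : ∀ (T : EReal) (v : ℝ → PolyParabolic.H0 N m Ω),
      PolyParabolic.IsSolution n v₀ T v → ∀ t : ℝ, 0 ≤ t → (t : EReal) < T →
        (n + 2) / (n + 1) * v₀.energy * t ≤
          ∫ x in (Ω : Set (EuclideanSpace ℝ (Fin N))),
            |(v t).fn x| ^ ((n + 2) / (n + 1)) := by
    intro T v hv t ht htT
    have h := PolyParabolic.linear_growth_of_subgradient_flow hBsymm
      (P := PolyParabolic.H0.psiDual hn)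
      (G := fun v => ∫ x in (Ω : Set (EuclideanSpace ℝ (Fin N))),
        |v.fn x| ^ ((n + 2) / (n + 1))) (c := n + 2) (by positivity)
      (fun v => integral_nonneg fun x => by positivity)
      (PolyParabolic.H0.mul_psiDual_sub_le hn) hv.continuousOn
      (fun w t ht htT => by rw [hB]; exact hv.weak_form w t ht htT) ht htT
    rw [hBE, hv.initial] at h
    refine le_trans ?_ h
    gcongr
    exact div_le_self (by positivity) (by linarith)
  refine ⟨hgrowth, fun v hv => ?_⟩
  have hlim : Tendsto (fun t : ℝ => ∫ x in (Ω : Set (EuclideanSpace ℝ (Fin N))),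
      |(v t).fn x| ^ ((n + 2) / (n + 1))) atTop atTop := by
    have hslope : 0 < (n + 2) / (n + 1) * v₀.energy := by positivity
    refine tendsto_atTop_mono' _ ?_ (tendsto_id.const_mul_atTop hslope)
    filter_upwards [eventually_ge_atTop 0] with t ht
    exact hgrowth ⊤ v hv t ht (EReal.coe_lt_top t)
  refine ⟨hlim, ?_⟩
  rintro ⟨M, hM⟩
  obtain ⟨t, ht, ht0⟩ := ((hlim.eventually_gt_atTop
    (∫ _ in (Ω : Set (EuclideanSpace ℝ (Fin N))), M ^ ((n + 2) / (n + 1)))).and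
      (eventually_gt_atTop 0)).exists
  refine absurd ht (not_lt.2 ?_)
  refine integral_mono_ae (PolyParabolic.H0.integrable_abs_rpow hn (v t)) (integrable_const _) ?_
  filter_upwards [hM t ht0] with x hx
  exact Real.rpow_le_rpow (abs_nonneg _) hx (by positivity)
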